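/- Let $X_1,\dots,X_N$ be records with $p$ categorical features and labels $y_1,\dots,y_N$ in a finite set $C$ of classes; view a record as the set of its items (pairs of a feature and its value), and let $s$ be a pattern, i.e. a set of items, that is contained in at least one record. Let $I^{(c)}=\{i: y_i=c\}$, assumed non-empty for every $c\in C$, and $I_s=\{i: s\subseteq X_i\}$. Put $p_s^{(c)}=|I^{(c)}\cap I_s|/|I^{(c)}|$ (frequency), $q_s^{(c)}=|I^{(c)}\cap I_s|/|I_s|$ (confidence), $p^{(c)}=|I^{(c)}|/N$ (prior) and $p_s=\sum_{c\in C}p_s^{(c)}p^{(c)}$. Fix $D\ge 1$. For every class $c$ and every $m=1,2,\dots$ draw $D$ records uniformly from the records of class $c$ (all draws, within a chain, across chains and across classes, are independent), and let the $m$-th chain of class $c$ be $S^{(c)}_{1,m}\supseteq\dots\supseteq S^{(c)}_{D,m}$, where $S^{(c)}_{d,m}$ is the intersection of the first $d$ drawn records. Let $k^{(c)}_{s,m}=\max\{d: s\subseteq S^{(c)}_{d,m}\}$ (and $0$ if there is no such $d$), $\chi^{(c)}_{s,m}=\mathbf 1_{\{k^{(c)}_{s,m}<D\}}$, $$\hat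 p_s^{(c)}=\frac{\sum_{m=1}^M k^{(c)}_{s,m}}{\sum_{m=1}^M\bigl(k^{(c)}_{s,m}+\chi^{(c)}_{s,m}\bigr)},\qquad \hat q_s^{(c)}=\frac{\hat p_s^{(c)}p^{(c)}}{\sum_{c'\in C}\hat p_s^{(c')}p^{(c')}}$$ (with $\hat q_s^{(c)}=0$ if the denominator vanishes). Then for every $c\in C$, as $M\to\infty$, $$\sqrt M\,\bigl[\hat q_s^{(c)}-q_s^{(c)}\bigr]\ \xrightarrow{\ d\ }\ N(0,\tau^2),$$ where $$\tau^2=\left[\frac{p_s^{(c)}p^{(c)}}{p_s^2}\right]^2\sum_{c'\in C}\frac{[1-p_s^{(c')}]^2p_s^{(c')}}{1-(p_s^{(c')})^D}\,(p^{(c')})^2+\left[\frac{p^{(c)}}{p_s^2}\right]^2\frac{[1-p_s^{(c)}]^2p_s^{(c)}}{1-(p_s^{(c)})^D}\,p_s\bigl(p_s-2p_s^{(c)}p^{(c)}\bigr)\ \ge 0;$$ the fraction $[1-x]^2x/(1-x^D)$ is read as its limit $0$ at $x=1$, and $N(0,0)$ is the point mass at $0$. -/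

import Mathlib

open MeasureTheory ProbabilityTheory Filter

namespace RIChains

/-- An item `(j, v)` stands for "the value of categorical feature `j` is `v`". -/
abbrev Item (p : ℕ) : Type := Fin p × ℕ

/-- A record `[x₁, …, x_p]`, viewed as the itemset `{(1, x₁), …, (p, x_p)}`. -/
def items {p : ℕ} (x : Fin p → ℕ) : Finset (Item p) :=
  Finset.univ.image (fun j => (j, x j))

section DataSet

variable {N p : ℕ} {C : Type*} [DecidableEq C]

/-- `I^{(c)}`: the observations with label `c`. -/
def classIdx (y : Fin N → C) (c : C) : Finset (Fin N) :=
  Finset.univ.filter (fun i => y i = c)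

/-- `I_s`: the observations containing the pattern `s`. -/
def patternIdx (X : Fin N → Fin p → ℕ) (s : Finset (Item p)) : Finset (Fin N) :=
  Finset.univ.filter (fun i => s ⊆ items (X i))

/-- The frequency `p_s^{(c)}` of `s` in class `c`: the proportion of the records with label `c`
that contain `s`. -/
noncomputable def freq (X : Fin N → Fin p → ℕ) (y : Fin N → C) (s : Finset (Item p)) (c : C) : ℝ :=
  ((classIdx y c ∩ patternIdx X s).card : ℝ) / ((classIdx y c).card : ℝ)

/-- The confidence `q_s^{(c)}` of `s` for class `c`: the proportion of the records containing `s`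
that have label `c`. -/
noncomputable def confidence (X : Fin N → Fin p → ℕ) (y : Fin N → C) (s : Finset (Item p))
    (c : C) : ℝ :=
  ((classIdx y c ∩ patternIdx X s).card : ℝ) / ((patternIdx X s).card : ℝ)

/-- The class prior `p^{(c)} = |I^{(c)}| / N`. -/
noncomputable def prior (y : Fin N → C) (c : C) : ℝ :=
  ((classIdx y c).card : ℝ) / (N : ℝ)

/-- The marginal probability `p_s = ∑_c p_s^{(c)} p^{(c)}` of `s`. -/
noncomputable def marginal [Fintype C] (X : Fin N → Fin p → ℕ) (y : Fin N → C)
    (s : Finset (Item p)) : ℝ :=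
  ∑ c, freq X y s c * prior y c

/-- The asymptotic variance `(1 - p_s^{(c)})² p_s^{(c)} / (1 - (p_s^{(c)})^D)` of the frequency
estimator in class `c`. For `p_s^{(c)} = 1` the fraction is `0 / 0`, which is `0` here; this is
also its limit as `p_s^{(c)}` tends to `1` (for `D ≥ 1`). -/
noncomputable def freqVar (X : Fin N → Fin p → ℕ) (y : Fin N → C) (s : Finset (Item p)) (D : ℕ)
    (c : C) : ℝ :=
  (1 - freq X y s c) ^ 2 * freq X y s c / (1 - freq X y s c ^ D)

/-- The asymptotic variance `τ²` of the confidence estimator for class `c`. -/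
noncomputable def tauSq [Fintype C] (X : Fin N → Fin p → ℕ) (y : Fin N → C)
    (s : Finset (Item p)) (D : ℕ) (c : C) : ℝ :=
  (freq X y s c * prior y c / marginal X y s ^ 2) ^ 2 *
      ∑ c', freqVar X y s D c' * prior y c' ^ 2
    + (prior y c / marginal X y s ^ 2) ^ 2 * freqVar X y s D c *
      (marginal X y s * (marginal X y s - 2 * freq X y s c * prior y c))

end DataSet

section Chains

variable {N p D : ℕ}

/-- The nodes of the chain of length `D` produced by the draws `i`, indexed from `0`: the head
node is the first drawn record, and each further node is the intersection of its predecessor with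
the next drawn record. -/
def chainNode (X : Fin N → Fin p → ℕ) (i : Fin D → Fin N) : (d : ℕ) → d < D → Finset (Item p)
  | 0, h => items (X (i ⟨0, h⟩))
  | d + 1, h => chainNode X i d (Nat.lt_of_succ_lt h) ∩ items (X (i ⟨d + 1, h⟩))

/-- `k_s`: the largest `d ∈ {1, …, D}` such that the `d`-th node of the chain contains `s`, and `0`
if no node contains `s`. -/
def appearances (X : Fin N → Fin p → ℕ) (s : Finset (Item p)) (i : Fin D → Fin N) : ℕ :=
  (Finset.univ.filter (fun d : Fin D => s ⊆ chainNode X i d.1 d.2)).sup (fun d => d.1 + 1)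

/-- `χ_s`: the indicator of `k_s < D`. -/
def chi (X : Fin N → Fin p → ℕ) (s : Finset (Item p)) (i : Fin D → Fin N) : ℕ :=
  if appearances X s i < D then 1 else 0

/-- The estimated frequency from the first `M` chains, `∑ k_{s,m} / ∑ (k_{s,m} + χ_{s,m})`;
`draws m` are the records drawn for the `m`-th chain. -/
noncomputable def freqHat (X : Fin N → Fin p → ℕ) (s : Finset (Item p)) (M : ℕ)
    (draws : ℕ → Fin D → Fin N) : ℝ :=
  (∑ m ∈ Finset.range M, (appearances X s (draws m) : ℝ)) /
    ∑ m ∈ Finset.range M, ((appearances X s (draws m) : ℝ) + (chi X s (draws m) : ℝ))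

/-- The estimated confidence of `s` for class `c`, obtained by Bayes' theorem from the estimated
frequencies in all classes; `draws c' m` are the records drawn for the `m`-th chain of
class `c'`. -/
noncomputable def confHat {C : Type*} [Fintype C] [DecidableEq C] (X : Fin N → Fin p → ℕ)
    (y : Fin N → C) (s : Finset (Item p)) (M : ℕ) (draws : C → ℕ → Fin D → Fin N) (c : C) : ℝ :=
  freqHat X s M (draws c) * prior y c / ∑ c', freqHat X s M (draws c') * prior y c'

end Chains

end RIChains

namespace RIChains

open scoped Topology

/-! For one chain, `k + χ` counts the records inspected up to the first one without `s`, capped at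
`D`, and `k` counts the successes among them. With success probability `p`, tail sums give `E k = p
· E (k + χ)`, so the score `k - p (k + χ)` is centred; a telescoping expansion gives its variance `p
(1 - p ^ D)` (`integral_score_sq`). The error of `freqHat` is the sum of scores over the sum of `k +
χ`.

Bayes' formula is a quotient of linear forms in the frequencies, so the error of `confHat` is an
exact linear combination of frequency errors with a random denominator (`confidence_sub_eq`). No
Taylor remainder arises: `√M` times the error is `∑ G * (b + R)`, where `G` are normalized score
sums, `b` constants, and `R → 0` almost surely by the law of large numbers. As `G` is bounded in
`L²`, `G * R` vanishes in probability (`tendstoInMeasure_mul_zero`), and `∑ b * G` obeys a scalar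
central limit theorem (`tendstoInDistribution_sum_score`). `sum_confGrad_sq` identifies the
variance. -/

/-! ### Independence of rows and convergence in probability. -/

/-- Grouping the members of an independent family indexed by a product into rows gives
independent rows. -/
theorem iIndepFun_curry {Ω ι κ E : Type*} [MeasurableSpace Ω] [MeasurableSpace E] [Countable ι]
    [Countable κ] {μ : Measure Ω} [IsProbabilityMeasure μ] {f : ι → κ → Ω → E}
    (hf : ∀ i j, AEMeasurable (f i j) μ)
    (h : iIndepFun (fun t : ι × κ => f t.1 t.2) μ) :
    iIndepFun (fun i ω j => f i j ω) μ := by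
  have hprob : ∀ i j, IsProbabilityMeasure (μ.map (f i j)) :=
    fun i j => Measure.isProbabilityMeasure_map (hf i j)
  have hrow : ∀ i, AEMeasurable (fun ω j => f i j ω) μ := fun i => aemeasurable_pi_lambda _ (hf i)
  have hrowp : ∀ i, IsProbabilityMeasure (μ.map (fun ω j => f i j ω)) :=
    fun i => Measure.isProbabilityMeasure_map (hrow i)
  -- `Measure.infinitePi_map_piCurry` curries over a sigma type, hence the reindexing of the
  -- product.
  have hσ : iIndepFun (fun t : (Σ _ : ι, κ) => f t.1 t.2) μ :=
    h.precomp (g := Equiv.sigmaEquivProd ι κ) (Equiv.injective _)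
  have hlaw := hσ.map_fun_eq_infinitePi_map₀' (fun t : (Σ _ : ι, κ) => hf t.1 t.2)
  rw [iIndepFun_iff_map_fun_eq_infinitePi_map₀' hrow]
  have hrowlaw : ∀ i, μ.map (fun ω j => f i j ω) = Measure.infinitePi fun j => μ.map (f i j) := by
    intro i
    exact (h.precomp (g := fun j => (i, j)) (fun _ _ e => by simpa using e)
      ).map_fun_eq_infinitePi_map₀' (hf i)
  simp_rw [hrowlaw]
  rw [← Measure.infinitePi_map_piCurry (fun i j => μ.map (f i j)), ← hlaw,
    AEMeasurable.map_map_of_aemeasurable (by fun_prop)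
      (aemeasurable_pi_lambda _ fun t : (Σ _ : ι, κ) => hf t.1 t.2)]
  rfl

theorem tendstoInMeasure_add_zero {Ω : Type*} [MeasurableSpace Ω] {μ : Measure Ω}
    [IsFiniteMeasure μ] {f g : ℕ → Ω → ℝ} (hf : TendstoInMeasure μ f atTop 0)
    (hg : TendstoInMeasure μ g atTop 0) :
    TendstoInMeasure μ (fun n ω => f n ω + g n ω) atTop 0 := by
  rw [tendstoInMeasure_iff_measureReal_norm] at *
  intro ε hε
  have := (hf (ε / 2) (by positivity)).add (hg (ε / 2) (by positivity))
  rw [add_zero] at this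
  refine squeeze_zero (fun _ => measureReal_nonneg) (fun n => ?_) this
  refine (measureReal_mono ?_).trans (measureReal_union_le _ _)
  intro ω hω
  simp only [Pi.zero_apply, sub_zero, Set.mem_union, Set.mem_ofPred_eq] at hω ⊢
  by_contra! hc
  have := norm_add_le (f n ω) (g n ω)
  linarith

theorem tendstoInMeasure_sum_zero {Ω ι : Type*} [MeasurableSpace Ω] {μ : Measure Ω}
    [IsFiniteMeasure μ] (s : Finset ι) {f : ι → ℕ → Ω → ℝ}
    (hf : ∀ i, TendstoInMeasure μ (f i) atTop 0) :
    TendstoInMeasure μ (fun n ω => ∑ i ∈ s, f i n ω) atTop 0 := by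
  classical
  induction s using Finset.induction_on with
  | empty =>
    simpa using tendstoInMeasure_of_tendsto_ae (μ := μ) (f := fun (_ : ℕ) (_ : Ω) => (0 : ℝ))
      (g := 0) (fun _ => aestronglyMeasurable_const) (by simp)
  | insert a s ha ih =>
    simpa [Finset.sum_insert ha] using tendstoInMeasure_add_zero (hf a) ih

/-- If `R n` converges to `0` in probability and `G n` is bounded in `L²`, then `G n * R n`
converges to `0` in probability. -/
theorem tendstoInMeasure_mul_zero {Ω : Type*} [MeasurableSpace Ω] {μ : Measure Ω}
    [IsFiniteMeasure μ] {G R : ℕ → Ω → ℝ} {K : ℝ} (hG : ∀ n, MemLp (G n) 2 μ)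
    (hK : ∀ n, ∫ ω, G n ω ^ 2 ∂μ ≤ K) (hR : TendstoInMeasure μ R atTop 0) :
    TendstoInMeasure μ (fun n ω => G n ω * R n ω) atTop 0 := by
  rw [tendstoInMeasure_iff_measureReal_norm] at *
  intro ε hε
  simp only [Pi.zero_apply, sub_zero] at *
  have hK0 : 0 ≤ K := (integral_nonneg fun ω => sq_nonneg _).trans (hK 0)
  -- A large product forces `|G n| ≥ ε / δ`, controlled by Chebyshev uniformly in `n`, or `|R n| ≥
  -- δ`.
  have key : ∀ δ > 0, ∀ n, μ.real {ω | ε ≤ ‖G n ω * R n ω‖} ≤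
      δ ^ 2 / ε ^ 2 * K + μ.real {ω | δ ≤ ‖R n ω‖} := by
    intro δ hδ n
    have h1 := mul_meas_ge_le_integral_of_nonneg (μ := μ) (f := fun ω => G n ω ^ 2)
      (ae_of_all _ fun ω => sq_nonneg _) (hG n).integrable_sq ((ε / δ) ^ 2)
    have h2 : μ.real {ω | (ε / δ) ^ 2 ≤ G n ω ^ 2} ≤ δ ^ 2 / ε ^ 2 * K := by
      calc _ = δ ^ 2 / ε ^ 2 * ((ε / δ) ^ 2 * μ.real {ω | (ε / δ) ^ 2 ≤ G n ω ^ 2}) := by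
            field_simp
        _ ≤ _ := by gcongr; exact h1.trans (hK n)
    refine (measureReal_mono ?_).trans ((measureReal_union_le _ _).trans (add_le_add_left h2 _))
    intro ω hω
    simp only [Set.mem_union, Set.mem_ofPred_eq, norm_mul, Real.norm_eq_abs] at hω ⊢
    by_contra! hc
    have h3 : |G n ω| < ε / δ := by
      rw [← sq_abs (G n ω)] at hc
      exact lt_of_pow_lt_pow_left₀ 2 (by positivity) hc.1
    have h4 : |G n ω| * |R n ω| < ε / δ * δ := by
      refine mul_lt_mul'' h3 hc.2 (abs_nonneg _) (abs_nonneg _)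
    rw [div_mul_cancel₀ _ hδ.ne'] at h4
    linarith
  rw [Metric.tendsto_atTop]
  intro η hη
  obtain ⟨δ, hδ, hδη⟩ : ∃ δ > 0, δ ^ 2 / ε ^ 2 * K < η / 2 := by
    have : Tendsto (fun δ : ℝ => δ ^ 2 / ε ^ 2 * K) (𝓝[>] 0) (𝓝 0) := by
      have h : Continuous fun δ : ℝ => δ ^ 2 / ε ^ 2 * K := by fun_prop
      simpa using (h.tendsto 0).mono_left nhdsWithin_le_nhds
    obtain ⟨δ, h1, h2⟩ := ((this.eventually_lt_const (half_pos hη)).and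
      self_mem_nhdsWithin).exists
    exact ⟨δ, h2, h1⟩
  obtain ⟨n₀, hn₀⟩ := Metric.tendsto_atTop.1 (hR δ hδ) (η / 2) (half_pos hη)
  refine ⟨n₀, fun n hn => ?_⟩
  have h5 := hn₀ n hn
  rw [Real.dist_0_eq_abs, abs_of_nonneg measureReal_nonneg] at *
  have := key δ hδ n
  linarith

/-! ### Counting successes along a chain. -/

section Combinatorics
variable {N p D : ℕ} (X : Fin N → Fin p → ℕ) (s : Finset (Item p)) (i : Fin D → Fin N)

theorem subset_chainNode_iff (d : ℕ) (hd : d < D) :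
    s ⊆ chainNode X i d hd ↔ ∀ j : Fin D, j.1 ≤ d → s ⊆ items (X (i j)) := by
  induction d with
  | zero =>
    rw [chainNode]
    constructor
    · intro h j hj
      obtain rfl : j = ⟨0, hd⟩ := Fin.ext (by simpa using hj)
      exact h
    · exact fun h => h _ le_rfl
  | succ d ih =>
    rw [chainNode, Finset.subset_inter_iff, ih]
    constructor
    · rintro ⟨h1, h2⟩ j hj
      rcases hj.lt_or_eq with h | h
      · exact h1 j (Nat.lt_succ_iff.1 h)
      · obtain rfl : j = ⟨d + 1, hd⟩ := Fin.ext h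
        exact h2
    · exact fun h => ⟨fun j hj => h j (hj.trans (Nat.le_succ d)), h _ le_rfl⟩

theorem appearances_le : appearances X s i ≤ D :=
  Finset.sup_le fun d _ => d.2

/-- Nodes decrease along the chain, so only the first `n` draws matter. Beyond `D` the right side
would no longer constrain `n`. -/
theorem le_appearances_iff {n : ℕ} (hn : n ≤ D) :
    n ≤ appearances X s i ↔ ∀ j : Fin D, j.1 < n → s ⊆ items (X (i j)) := by
  rcases n with _ | n
  · simp
  · rw [appearances, Finset.le_sup_iff (Nat.succ_pos n)]
    simp only [Finset.mem_filter, Finset.mem_univ, true_and, subset_chainNode_iff]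
    constructor
    · rintro ⟨d, hd, hnd⟩ j hj
      exact hd j (by omega)
    · intro h
      exact ⟨⟨n, hn⟩, fun j hj => h j (Nat.lt_succ_of_le hj), le_rfl⟩

theorem appearances_eq_sum :
    (appearances X s i : ℝ) =
      ∑ n ∈ Finset.range D, if n + 1 ≤ appearances X s i then (1 : ℝ) else 0 := by
  rw [Finset.sum_boole]
  congr 1
  have : (Finset.range D).filter (fun n => n + 1 ≤ appearances X s i) =
      Finset.range (appearances X s i) := by
    ext n
    have := appearances_le X s i
    simp only [Finset.mem_filter, Finset.mem_range]
    omega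
  rw [this, Finset.card_range]

/-- `k + χ = min (k + 1) D`: compared with the tail sum for `k`, every threshold drops by one. -/
theorem appearances_add_chi_eq_sum :
    (appearances X s i : ℝ) + chi X s i =
      ∑ n ∈ Finset.range D, if n ≤ appearances X s i then (1 : ℝ) else 0 := by
  rw [Finset.sum_boole, chi]
  norm_cast
  have h := appearances_le X s i
  split_ifs with hlt
  · have : (Finset.range D).filter (fun n => n ≤ appearances X s i) =
        Finset.range (appearances X s i + 1) := by
      ext n
      simp only [Finset.mem_filter, Finset.mem_range]
      omega
    rw [this, Finset.card_range]
  · have : (Finset.range D).filter (fun n => n ≤ appearances X s i) = Finset.range D := by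
      ext n
      simp only [Finset.mem_filter, Finset.mem_range]
      omega
    rw [this, Finset.card_range]
    omega

theorem one_le_appearances_add_chi (hD : 1 ≤ D) :
    (1 : ℝ) ≤ (appearances X s i : ℝ) + chi X s i := by
  rw [chi]
  split_ifs with h
  · simp
  · norm_cast
    omega

end Combinatorics

/-- A telescoping expansion of the square of a centred count of successes before the first
failure, as a linear combination of indicators of the events that the first `n` trials succeed. -/
theorem sq_sum_indicator_sub (k n : ℕ) (q : ℝ) :
    (∑ d ∈ Finset.range n, (if d + 1 ≤ k then (1 : ℝ) else 0) -
        q * ∑ d ∈ Finset.range n, if d ≤ k then (1 : ℝ) else 0) ^ 2 =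
      ∑ d ∈ Finset.range n,
        ((2 * d * (1 - q) + 1 - 2 * q) * (if d + 1 ≤ k then (1 : ℝ) else 0) +
          (q ^ 2 - 2 * d * (1 - q) * q) * if d ≤ k then (1 : ℝ) else 0) := by
  induction n with
  | zero => simp
  | succ n ih =>
    rw [Finset.sum_range_succ, Finset.sum_range_succ, Finset.sum_range_succ, ← ih]
    -- If `n ≤ k`, all earlier indicators are `1` and the increment of the square is explicit;
    -- otherwise both new indicators vanish.
    by_cases hn : n ≤ k
    · have h1 : ∑ d ∈ Finset.range n, (if d + 1 ≤ k then (1 : ℝ) else 0) = n := by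
        rw [Finset.sum_congr rfl fun d hd => if_pos ?_]
        · simp
        · have := Finset.mem_range.1 hd
          omega
      have h2 : ∑ d ∈ Finset.range n, (if d ≤ k then (1 : ℝ) else 0) = n := by
        rw [Finset.sum_congr rfl fun d hd => if_pos ?_]
        · simp
        · have := Finset.mem_range.1 hd
          omega
      rw [h1, h2, if_pos hn]
      split_ifs <;> ring
    · rw [if_neg hn, if_neg (by omega)]
      ring

/-! ### Moments of the score under the law of one chain. -/

section Moments
variable {N p D : ℕ} {C : Type*} [DecidableEq C] (X : Fin N → Fin p → ℕ) (y : Fin N → C)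
  (s : Finset (Item p))

/-- The law of the draws of one chain of class `c`. -/
noncomputable def chainLaw (D : ℕ) (c : C) : Measure (Fin D → Fin N) :=
  Measure.pi fun _ => uniformOn (classIdx y c : Set (Fin N))

theorem isProbabilityMeasure_chainLaw {y : Fin N → C} {c : C} (hc : (classIdx y c).Nonempty) :
    IsProbabilityMeasure (chainLaw y D c) := by
  have : IsProbabilityMeasure (uniformOn (classIdx y c : Set (Fin N))) :=
    isProbabilityMeasure_uniformOn (Finset.finite_toSet _) hc
  unfold chainLaw
  infer_instance

theorem uniformOn_real_patternIdx (c : C) :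
    (uniformOn (classIdx y c : Set (Fin N))).real (patternIdx X s) = freq X y s c := by
  rw [measureReal_def, uniformOn_apply_finset, freq]
  simp

/-- The event is a box: the first `n` coordinates lie in `patternIdx X s`, the others are free. -/
theorem chainLaw_real_le_appearances {c : C} (hc : (classIdx y c).Nonempty) {n : ℕ} (hn : n ≤ D) :
    (chainLaw y D c).real {i | n ≤ appearances X s i} = freq X y s c ^ n := by
  have : IsProbabilityMeasure (uniformOn (classIdx y c : Set (Fin N))) :=
    isProbabilityMeasure_uniformOn (Finset.finite_toSet _) hc
  have hset : {i : Fin D → Fin N | n ≤ appearances X s i} =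
      Set.pi Set.univ fun j : Fin D => if j.1 < n then (patternIdx X s : Set (Fin N))
        else Set.univ := by
    ext i
    simp only [Set.mem_ofPred_eq, le_appearances_iff X s i hn, Set.mem_pi, Set.mem_univ,
      true_implies]
    refine forall_congr' fun j => ?_
    by_cases hj : j.1 < n <;> simp [hj, patternIdx]
  rw [hset, measureReal_def, chainLaw, Measure.pi_pi, ENNReal.toReal_prod]
  have hterm : ∀ j : Fin D, ((uniformOn (classIdx y c : Set (Fin N)))
      (if j.1 < n then (patternIdx X s : Set (Fin N)) else Set.univ)).toReal =
      if j.1 < n then freq X y s c else 1 := by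
    intro j
    by_cases hj : j.1 < n
    · simp only [hj, if_true]
      exact uniformOn_real_patternIdx X y s c
    · simp [hj]
  simp_rw [hterm]
  rw [Finset.prod_ite, Finset.prod_const, Finset.prod_const_one, mul_one]
  congr 1
  rw [Fin.card_filter_val_lt]
  omega

theorem integral_indicator_le_appearances {c : C} (hc : (classIdx y c).Nonempty) {n : ℕ}
    (hn : n ≤ D) :
    ∫ i, (if n ≤ appearances X s i then (1 : ℝ) else 0) ∂(chainLaw y D c) =
      freq X y s c ^ n := by
  rw [← chainLaw_real_le_appearances X y s hc hn, ← integral_indicator_one (by measurability)]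
  simp [Set.indicator_apply]

/-- The centred count `k - p_s^{(c)} (k + χ)` of one chain. -/
noncomputable def score (c : C) (i : Fin D → Fin N) : ℝ :=
  appearances X s i - freq X y s c * ((appearances X s i : ℝ) + chi X s i)

/-- The geometric sum is left unevaluated, so frequency `1` needs no separate case. -/
theorem integral_appearances_add_chi {c : C} (hc : (classIdx y c).Nonempty) :
    ∫ i, ((appearances X s i : ℝ) + chi X s i) ∂(chainLaw y D c) =
      ∑ n ∈ Finset.range D, freq X y s c ^ n := by
  have := isProbabilityMeasure_chainLaw (D := D) hc
  simp_rw [appearances_add_chi_eq_sum]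
  rw [integral_finsetSum _ fun _ _ => Integrable.of_finite]
  exact Finset.sum_congr rfl fun n hn =>
    integral_indicator_le_appearances X y s hc (Finset.mem_range.1 hn).le

theorem integral_appearances {c : C} (hc : (classIdx y c).Nonempty) :
    ∫ i, (appearances X s i : ℝ) ∂(chainLaw y D c) =
      freq X y s c * ∑ n ∈ Finset.range D, freq X y s c ^ n := by
  have := isProbabilityMeasure_chainLaw (D := D) hc
  simp_rw [appearances_eq_sum]
  rw [integral_finsetSum _ fun _ _ => Integrable.of_finite, Finset.mul_sum]
  refine Finset.sum_congr rfl fun n hn => ?_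
  rw [integral_indicator_le_appearances X y s hc (Finset.mem_range.1 hn), pow_succ']

theorem integral_score {c : C} (hc : (classIdx y c).Nonempty) :
    ∫ i, score X y s c i ∂(chainLaw y D c) = 0 := by
  have := isProbabilityMeasure_chainLaw (D := D) hc
  simp only [score]
  rw [integral_sub Integrable.of_finite Integrable.of_finite, integral_const_mul,
    integral_appearances X y s hc, integral_appearances_add_chi X y s hc, sub_self]

theorem integral_score_sq {c : C} (hc : (classIdx y c).Nonempty) :
    ∫ i, score X y s c i ^ 2 ∂(chainLaw y D c) =
      freq X y s c * (1 - freq X y s c ^ D) := by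
  have := isProbabilityMeasure_chainLaw (D := D) hc
  simp_rw [score, appearances_add_chi_eq_sum]
  rw [integral_congr_ae (ae_of_all _ fun i => by
    rw [appearances_eq_sum X s i, sq_sum_indicator_sub])]
  rw [integral_finsetSum _ fun _ _ => Integrable.of_finite]
  -- In expectation the parts of the coefficients proportional to `n` cancel, leaving a telescoping
  -- sum.
  have hterm : ∀ n ∈ Finset.range D,
      ∫ i, ((2 * n * (1 - freq X y s c) + 1 - 2 * freq X y s c) *
          (if n + 1 ≤ appearances X s i then (1 : ℝ) else 0) +
        (freq X y s c ^ 2 - 2 * n * (1 - freq X y s c) * freq X y s c) *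
          if n ≤ appearances X s i then (1 : ℝ) else 0) ∂(chainLaw y D c) =
      freq X y s c * (freq X y s c ^ n - freq X y s c ^ (n + 1)) := by
    intro n hn
    have hn : n + 1 ≤ D := Finset.mem_range.1 hn
    rw [integral_add Integrable.of_finite Integrable.of_finite, integral_const_mul,
      integral_const_mul, integral_indicator_le_appearances X y s hc hn,
      integral_indicator_le_appearances X y s hc (Nat.le_of_succ_le hn)]
    ring
  rw [Finset.sum_congr rfl hterm, ← Finset.mul_sum, Finset.sum_range_sub', pow_zero]

end Moments

/-! ### Bayes' formula and the variance without its singularity. -/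

section Proportions
variable {N p : ℕ} {C : Type*} [DecidableEq C] (X : Fin N → Fin p → ℕ) (y : Fin N → C)
  (s : Finset (Item p))

theorem freq_nonneg (c : C) : 0 ≤ freq X y s c := by
  unfold freq
  positivity

theorem freq_le_one (c : C) : freq X y s c ≤ 1 := by
  unfold freq
  exact div_le_one_of_le₀ (by exact_mod_cast Finset.card_le_card Finset.inter_subset_left)
    (by positivity)

theorem freq_mul_prior {c : C} (hc : (classIdx y c).Nonempty) :
    freq X y s c * prior y c = ((classIdx y c ∩ patternIdx X s).card : ℝ) / N := by
  have : ((classIdx y c).card : ℝ) ≠ 0 := by exact_mod_cast hc.card_pos.ne'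
  rw [freq, prior]
  field_simp

theorem marginal_eq [Fintype C] (hy : ∀ c, (classIdx y c).Nonempty) :
    marginal X y s = ((patternIdx X s).card : ℝ) / N := by
  rw [marginal, Finset.sum_congr rfl fun c _ => freq_mul_prior X y s (hy c), ← Finset.sum_div]
  congr 1
  rw [Finset.card_eq_sum_card_fiberwise (f := y) (t := Finset.univ) (by simp)]
  push_cast
  refine Finset.sum_congr rfl fun c _ => ?_
  congr 2
  ext i
  simp [classIdx, and_comm]

theorem marginal_pos [Fintype C] (hy : ∀ c, (classIdx y c).Nonempty)
    (hs : (patternIdx X s).Nonempty) : 0 < marginal X y s := by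
  rw [marginal_eq X y s hy]
  have : 0 < N := Fin.pos hs.choose
  have := hs.card_pos
  positivity

theorem confidence_eq [Fintype C] (hy : ∀ c, (classIdx y c).Nonempty)
    (hs : (patternIdx X s).Nonempty) (c : C) :
    confidence X y s c = freq X y s c * prior y c / marginal X y s := by
  rw [marginal_eq X y s hy, freq_mul_prior X y s (hy c), confidence]
  have : (N : ℝ) ≠ 0 := by exact_mod_cast (Fin.pos hs.choose).ne'
  field_simp

/-- A factor `1 - p` cancels through the geometric sum; at `p = 1` both sides are `0`, the left one
by the convention `0 / 0 = 0`. -/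
theorem freqVar_eq {D : ℕ} (hD : 1 ≤ D) (c : C) :
    freqVar X y s D c = freq X y s c * (1 - freq X y s c ^ D) /
      (∑ n ∈ Finset.range D, freq X y s c ^ n) ^ 2 := by
  rw [freqVar]
  rcases (freq_le_one X y s c).eq_or_lt with h | h
  · simp [h]
  · have h0 := freq_nonneg X y s c
    have hg : 1 - freq X y s c ^ D = (∑ n ∈ Finset.range D, freq X y s c ^ n) *
        (1 - freq X y s c) := (geom_sum_mul_neg _ _).symm
    have h1 : freq X y s c ^ D < 1 := pow_lt_one₀ h0 h (by omega)
    have h2 : 1 - freq X y s c ≠ 0 := by linarith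
    have h3 : (∑ n ∈ Finset.range D, freq X y s c ^ n) ≠ 0 := by
      rintro h3
      rw [h3, zero_mul] at hg
      linarith
    rw [hg]
    field_simp

end Proportions

/-! ### The sampling model and its limit theorems. -/

/-- The draws `ξ c m d` are independent, and uniform over the records of class `c`. -/
structure IsSample {N D : ℕ} {C : Type*} [DecidableEq C] {Ω : Type*} [MeasurableSpace Ω]
    (y : Fin N → C) (ξ : C → ℕ → Fin D → Ω → Fin N) (μ : Measure Ω) : Prop where
  nonempty : ∀ c, (classIdx y c).Nonempty
  law : ∀ c m d, HasLaw (ξ c m d) (uniformOn (classIdx y c : Set (Fin N))) μ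
  indep : iIndepFun (fun t : C × ℕ × Fin D => ξ t.1 t.2.1 t.2.2) μ

namespace IsSample
variable {N p D : ℕ} {C : Type*} [DecidableEq C] {Ω : Type*} [MeasurableSpace Ω]
  {μ : Measure Ω} {y : Fin N → C} {ξ : C → ℕ → Fin D → Ω → Fin N}

theorem hasLaw_chain (h : IsSample y ξ μ) (c : C) (m : ℕ) :
    HasLaw (fun ω d => ξ c m d ω) (chainLaw y D c) μ :=
  (h.indep.precomp (g := fun d => (c, m, d)) (fun _ _ e => by simpa using e)).hasLaw_pi
    (h.law c m)

theorem memLp_comp_chain (h : IsSample y ξ μ) (g : (Fin D → Fin N) → ℝ) (c : C) (m : ℕ)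
    (q : ENNReal) : MemLp (fun ω => g fun d => ξ c m d ω) q μ := by
  have := isProbabilityMeasure_chainLaw (D := D) (h.nonempty c)
  refine MemLp.comp_of_map (f := fun ω d => ξ c m d ω) ?_ (h.hasLaw_chain c m).aemeasurable
  rw [(h.hasLaw_chain c m).map_eq]
  exact MemLp.of_discrete

theorem integral_comp_chain (h : IsSample y ξ μ) (g : (Fin D → Fin N) → ℝ) (c : C) (m : ℕ) :
    ∫ ω, g (fun d => ξ c m d ω) ∂μ = ∫ i, g i ∂(chainLaw y D c) :=
  (h.hasLaw_chain c m).integral_comp (f := g) AEStronglyMeasurable.of_discrete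

theorem aemeasurable_comp_chain (h : IsSample y ξ μ) (g : (Fin D → Fin N) → ℝ) (c : C) (m : ℕ) :
    AEMeasurable (fun ω => g fun d => ξ c m d ω) μ :=
  (h.memLp_comp_chain g c m 1).aestronglyMeasurable.aemeasurable

theorem variance_score (X : Fin N → Fin p → ℕ) (s : Finset (Item p)) (h : IsSample y ξ μ) (c : C)
    (m : ℕ) :
    Var[fun ω => score X y s c fun d => ξ c m d ω; μ] =
      freq X y s c * (1 - freq X y s c ^ D) := by
  rw [variance_of_integral_eq_zero (h.memLp_comp_chain _ c m 2).aestronglyMeasurable.aemeasurable,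
    h.integral_comp_chain (fun i => score X y s c i ^ 2), integral_score_sq X y s (h.nonempty c)]
  rw [h.integral_comp_chain (score X y s c), integral_score X y s (h.nonempty c)]

theorem aemeasurable_freqHat (X : Fin N → Fin p → ℕ) (s : Finset (Item p))
    (h : IsSample y ξ μ) (c : C) (M : ℕ) :
    AEMeasurable (fun ω => freqHat X s M fun m d => ξ c m d ω) μ :=
  (Finset.aemeasurable_fun_sum _ fun m _ =>
    h.aemeasurable_comp_chain (fun i => (appearances X s i : ℝ)) c m).div
  (Finset.aemeasurable_fun_sum _ fun m _ =>
    h.aemeasurable_comp_chain (fun i => (appearances X s i : ℝ) + chi X s i) c m)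

variable [Fintype C]

/-- The `m`-th chains of all classes are pooled into one level: levels form the i.i.d. sequence to
which the scalar limit theorems apply. -/
theorem hasLaw_level (h : IsSample y ξ μ) (m : ℕ) :
    HasLaw (fun ω (t : C × Fin D) => ξ t.1 m t.2 ω)
      (Measure.pi fun t : C × Fin D => uniformOn (classIdx y t.1 : Set (Fin N))) μ :=
  (h.indep.precomp (g := fun t : C × Fin D => (t.1, m, t.2))
    (fun a b e => by simpa [Prod.ext_iff] using e)).hasLaw_pi (fun t => h.law t.1 m t.2)

theorem identDistrib_comp_level (h : IsSample y ξ μ) (g : (C × Fin D → Fin N) → ℝ) (m : ℕ) :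
    IdentDistrib (fun ω => g fun t => ξ t.1 m t.2 ω) (fun ω => g fun t => ξ t.1 0 t.2 ω) μ μ :=
  IdentDistrib.comp ⟨(h.hasLaw_level m).aemeasurable, (h.hasLaw_level 0).aemeasurable,
    (h.hasLaw_level m).map_eq.trans (h.hasLaw_level 0).map_eq.symm⟩ Measurable.of_discrete

variable [IsProbabilityMeasure μ]

theorem iIndepFun_level (h : IsSample y ξ μ) :
    iIndepFun (fun m ω (t : C × Fin D) => ξ t.1 m t.2 ω) μ :=
  iIndepFun_curry (f := fun m (t : C × Fin D) => ξ t.1 m t.2)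
    (fun m t => (h.law t.1 m t.2).aemeasurable)
    (h.indep.precomp (g := fun t : ℕ × C × Fin D => (t.2.1, t.1, t.2.2))
      (fun a b e => by
        simp only [Prod.mk.injEq] at e
        exact Prod.ext e.2.1 (Prod.ext e.1 e.2.2)))

theorem iIndepFun_class (h : IsSample y ξ μ) (m : ℕ) :
    iIndepFun (fun c ω d => ξ c m d ω) μ :=
  iIndepFun_curry (f := fun c d => ξ c m d) (fun c d => (h.law c m d).aemeasurable)
    (h.indep.precomp (g := fun t : C × Fin D => (t.1, m, t.2))
      (fun a b e => by simpa [Prod.ext_iff] using e))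

theorem iIndepFun_comp_level (h : IsSample y ξ μ) (g : (C × Fin D → Fin N) → ℝ) :
    iIndepFun (fun m ω => g fun t => ξ t.1 m t.2 ω) μ :=
  h.iIndepFun_level.comp (fun _ => g) fun _ => Measurable.of_discrete

theorem ae_tendsto_average (h : IsSample y ξ μ) (g : (Fin D → Fin N) → ℝ) (c : C) :
    ∀ᵐ ω ∂μ, Tendsto (fun M : ℕ => (∑ m ∈ Finset.range M, g fun d => ξ c m d ω) / M) atTop
      (𝓝 (∫ i, g i ∂(chainLaw y D c))) := by
  rw [← h.integral_comp_chain g c 0]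
  exact strong_law_ae_real (fun m ω => g fun d => ξ c m d ω)
    ((h.memLp_comp_chain g c 0 1).integrable le_rfl)
    (fun i j hij => (h.iIndepFun_comp_level fun v => g fun d => v (c, d)).indepFun hij)
    (h.identDistrib_comp_level fun v => g fun d => v (c, d))

variable (X : Fin N → Fin p → ℕ) (s : Finset (Item p))

theorem integral_sq_normalized_sum_le (h : IsSample y ξ μ) (c : C) (M : ℕ) :
    ∫ ω, ((√(M : ℝ))⁻¹ * ∑ m ∈ Finset.range M, score X y s c fun d => ξ c m d ω) ^ 2 ∂μ ≤
      freq X y s c * (1 - freq X y s c ^ D) := by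
  have hmem : ∀ m, MemLp (fun ω => score X y s c fun d => ξ c m d ω) 2 μ :=
    fun m => h.memLp_comp_chain _ c m 2
  have hvar : Var[∑ m ∈ Finset.range M, fun ω => score X y s c fun d => ξ c m d ω; μ] =
      M * (freq X y s c * (1 - freq X y s c ^ D)) := by
    rw [IndepFun.variance_sum (fun m _ => hmem m) (fun i _ j _ hij =>
      (h.iIndepFun_comp_level fun v => score X y s c fun d => v (c, d)).indepFun hij)]
    simp [h.variance_score X s c]
  have hint : ∫ ω, (∑ m ∈ Finset.range M, fun ω => score X y s c fun d => ξ c m d ω) ω ∂μ = 0 := by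
    simp only [Finset.sum_apply]
    rw [integral_finsetSum _ fun m _ => (hmem m).integrable (by norm_num)]
    refine Finset.sum_eq_zero fun m _ => ?_
    rw [h.integral_comp_chain (score X y s c), integral_score X y s (h.nonempty c)]
  rw [variance_of_integral_eq_zero
    (Finset.aemeasurable_sum _ fun m _ => (hmem m).aestronglyMeasurable.aemeasurable) hint] at hvar
  simp only [Finset.sum_apply] at hvar
  simp_rw [mul_pow]
  rw [integral_const_mul, hvar, inv_pow, Real.sq_sqrt (Nat.cast_nonneg M), ← mul_assoc]
  have h0 : 0 ≤ freq X y s c * (1 - freq X y s c ^ D) :=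
    mul_nonneg (freq_nonneg X y s c)
      (sub_nonneg.2 (pow_le_one₀ (freq_nonneg X y s c) (freq_le_one X y s c)))
  -- Equality fails in general at `M = 0`, where the normalization is `0⁻¹ = 0`.
  exact mul_le_of_le_one_left h0 (inv_mul_le_one (a := (M : ℝ)))

theorem variance_sum_score (h : IsSample y ξ μ) (b : C → ℝ) (m : ℕ) :
    Var[fun ω => ∑ c, b c * score X y s c fun d => ξ c m d ω; μ] =
      ∑ c, b c ^ 2 * (freq X y s c * (1 - freq X y s c ^ D)) := by
  have hfun : (fun ω => ∑ c, b c * score X y s c fun d => ξ c m d ω) =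
      ∑ c, fun ω => b c * score X y s c fun d => ξ c m d ω := by
    ext ω
    simp
  rw [hfun, IndepFun.variance_sum
    (fun c _ => h.memLp_comp_chain (fun i => b c * score X y s c i) c m 2)]
  · refine Finset.sum_congr rfl fun c _ => ?_
    rw [variance_const_mul, h.variance_score]
  · intro c _ c' _ hcc
    exact ((h.iIndepFun_class m).comp (fun c i => b c * score X y s c i)
      fun _ => Measurable.of_discrete).indepFun hcc

/-- The central limit theorem for linear combinations of the centred counts of all classes. -/
theorem tendstoInDistribution_sum_score (h : IsSample y ξ μ) (b : C → ℝ) :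
    TendstoInDistribution
      (fun (M : ℕ) ω => ∑ c, b c *
        ((√(M : ℝ))⁻¹ * ∑ m ∈ Finset.range M, score X y s c fun d => ξ c m d ω))
      atTop (id : ℝ → ℝ) (fun _ => μ)
      (gaussianReal 0
        (∑ c, b c ^ 2 * (freq X y s c * (1 - freq X y s c ^ D))).toNNReal) := by
  have hmem : MemLp (fun ω => ∑ c, b c * score X y s c fun d => ξ c 0 d ω) 2 μ :=
    memLp_finsetSum _ fun c _ => h.memLp_comp_chain (fun i => b c * score X y s c i) c 0 2
  have hmean : ∫ ω, ∑ c, b c * score X y s c (fun d => ξ c 0 d ω) ∂μ = 0 := by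
    rw [integral_finsetSum _ fun c _ =>
      (h.memLp_comp_chain (fun i => b c * score X y s c i) c 0 1).integrable le_rfl]
    refine Finset.sum_eq_zero fun c _ => ?_
    rw [integral_const_mul, h.integral_comp_chain (score X y s c),
      integral_score X y s (h.nonempty c), mul_zero]
  -- Each summand already mixes the classes with weights `b`, so no multivariate limit theorem is
  -- needed.
  have hclt := tendstoInDistribution_inv_sqrt_mul_sum_sub (P := μ)
    (X := fun m ω => ∑ c, b c * score X y s c fun d => ξ c m d ω)
    (P' := gaussianReal 0 (∑ c, b c ^ 2 * (freq X y s c * (1 - freq X y s c ^ D))).toNNReal)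
    (Y := id) (by rw [h.variance_sum_score]; exact HasLaw.id) hmem
    (h.iIndepFun_comp_level fun v => ∑ c, b c * score X y s c fun d => v (c, d))
    (h.identDistrib_comp_level fun v => ∑ c, b c * score X y s c fun d => v (c, d))
  refine hclt.congr (fun M => ae_of_all _ fun ω => ?_) (ae_of_all _ fun _ => rfl)
  simp only [hmean, mul_zero, sub_zero]
  rw [Finset.sum_comm, Finset.mul_sum]
  refine Finset.sum_congr rfl fun c _ => ?_
  rw [← Finset.mul_sum]
  ring

end IsSample

/-! ### Exact linearization of Bayes' formula. -/

section Linearization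
variable {N p : ℕ} {C : Type*} [Fintype C] [DecidableEq C]
  (X : Fin N → Fin p → ℕ) (y : Fin N → C) (s : Finset (Item p))

/-- `p_s²` times the partial derivative of the confidence for class `c` with respect to the
frequency in class `c'`. -/
noncomputable def confGrad (c c' : C) : ℝ :=
  (if c' = c then prior y c * marginal X y s else 0) - freq X y s c * prior y c * prior y c'

/-- Over a common denominator the terms quadratic in `f` cancel, so the identity is exact; the price
is one factor `∑ f * prior` where the derivative would have `marginal`. -/
theorem confidence_sub_eq (c : C) (f : C → ℝ) (hm : marginal X y s ≠ 0)
    (hf : ∑ c', f c' * prior y c' ≠ 0) :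
    f c * prior y c / ∑ c', f c' * prior y c' - freq X y s c * prior y c / marginal X y s =
      ∑ c', confGrad X y s c c' * (f c' - freq X y s c') /
        (marginal X y s * ∑ c', f c' * prior y c') := by
  have hsum : ∑ c', confGrad X y s c c' * (f c' - freq X y s c') =
      prior y c * marginal X y s * (f c - freq X y s c) -
        freq X y s c * prior y c * (∑ c', f c' * prior y c' - marginal X y s) := by
    have hdiff : ∑ c', f c' * prior y c' - marginal X y s =
        ∑ c', (f c' - freq X y s c') * prior y c' := by
      rw [marginal, ← Finset.sum_sub_distrib]
      exact Finset.sum_congr rfl fun _ _ => by ring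
    rw [hdiff, Finset.mul_sum]
    simp only [confGrad, sub_mul, ite_mul, zero_mul, Finset.sum_sub_distrib, Finset.sum_ite_eq',
      Finset.mem_univ, if_true]
    congr 1
    exact Finset.sum_congr rfl fun _ _ => by ring
  rw [← Finset.sum_div, hsum]
  field_simp
  ring

/-- The square of the rank-one part of `confGrad` gives the sum over all classes; the diagonal
square and the cross term survive only at `c' = c` and give the second summand of `tauSq`. -/
theorem sum_confGrad_sq {D : ℕ} (hD : 1 ≤ D) (c : C) :
    ∑ c', (confGrad X y s c c' / ((∑ n ∈ Finset.range D, freq X y s c' ^ n) *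
        marginal X y s ^ 2)) ^ 2 * (freq X y s c' * (1 - freq X y s c' ^ D)) =
      tauSq X y s D c := by
  have hterm : ∀ c', (confGrad X y s c c' / ((∑ n ∈ Finset.range D, freq X y s c' ^ n) *
        marginal X y s ^ 2)) ^ 2 * (freq X y s c' * (1 - freq X y s c' ^ D)) =
      (freq X y s c * prior y c / marginal X y s ^ 2) ^ 2 *
        (freqVar X y s D c' * prior y c' ^ 2) +
      if c' = c then (prior y c / marginal X y s ^ 2) ^ 2 * freqVar X y s D c *
        (marginal X y s * (marginal X y s - 2 * freq X y s c * prior y c)) else 0 := by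
    intro c'
    have h1 : (confGrad X y s c c' / ((∑ n ∈ Finset.range D, freq X y s c' ^ n) *
        marginal X y s ^ 2)) ^ 2 * (freq X y s c' * (1 - freq X y s c' ^ D)) =
        (confGrad X y s c c' / marginal X y s ^ 2) ^ 2 * freqVar X y s D c' := by
      rw [freqVar_eq X y s hD]
      simp only [div_eq_mul_inv, mul_inv, mul_pow, inv_pow]
      ring
    rw [h1, confGrad]
    split_ifs with h
    · subst h
      ring
    · ring
  rw [Finset.sum_congr rfl fun c' _ => hterm c', Finset.sum_add_distrib, ← Finset.mul_sum,
    Finset.sum_ite_eq' , if_pos (Finset.mem_univ c), tauSq]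

end Linearization

theorem freqHat_sub_freq {N p D : ℕ} {C : Type*} [DecidableEq C] (X : Fin N → Fin p → ℕ)
    (y : Fin N → C) (s : Finset (Item p)) (c : C) (M : ℕ) (draws : ℕ → Fin D → Fin N)
    (h : ∑ m ∈ Finset.range M,
      ((appearances X s (draws m) : ℝ) + (chi X s (draws m) : ℝ)) ≠ 0) :
    freqHat X s M draws - freq X y s c = (∑ m ∈ Finset.range M, score X y s c (draws m)) /
      ∑ m ∈ Finset.range M, ((appearances X s (draws m) : ℝ) + (chi X s (draws m) : ℝ)) := by
  simp only [freqHat, score, Finset.sum_sub_distrib, ← Finset.mul_sum]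
  field_simp

/-! ### Consistency and the Slutsky argument. -/

namespace IsSample
variable {N p D : ℕ} {C : Type*} [Fintype C] [DecidableEq C] {Ω : Type*} [MeasurableSpace Ω]
  {μ : Measure Ω} [IsProbabilityMeasure μ] {y : Fin N → C} {ξ : C → ℕ → Fin D → Ω → Fin N}
  (X : Fin N → Fin p → ℕ) (s : Finset (Item p))

theorem ae_tendsto_freqHat (h : IsSample y ξ μ) (hD : 1 ≤ D) (c : C) :
    ∀ᵐ ω ∂μ, Tendsto (fun M : ℕ => freqHat X s M fun m d => ξ c m d ω) atTop
      (𝓝 (freq X y s c)) := by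
  filter_upwards [h.ae_tendsto_average (fun i => (appearances X s i : ℝ)) c,
    h.ae_tendsto_average (fun i => (appearances X s i : ℝ) + chi X s i) c] with ω h1 h2
  rw [integral_appearances X y s (h.nonempty c)] at h1
  rw [integral_appearances_add_chi X y s (h.nonempty c)] at h2
  have hθ : 0 < ∑ n ∈ Finset.range D, freq X y s c ^ n := by
    have h0 := freq_nonneg X y s c
    calc (0 : ℝ) < freq X y s c ^ 0 := by simp
      _ ≤ _ := Finset.single_le_sum (f := fun n => freq X y s c ^ n)
        (fun n _ => pow_nonneg h0 n) (Finset.mem_range.2 hD)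
  have h3 := h1.div h2 hθ.ne'
  rw [mul_div_cancel_right₀ _ hθ.ne'] at h3
  refine h3.congr' ?_
  filter_upwards [eventually_ne_atTop 0] with M hM
  have : (M : ℝ) ≠ 0 := by exact_mod_cast hM
  simp only [freqHat, Pi.div_apply]
  rw [div_div_div_cancel_right₀ this]

theorem tendstoInDistribution_confHat (h : IsSample y ξ μ) (hs : (patternIdx X s).Nonempty)
    (hD : 1 ≤ D) (c : C) :
    TendstoInDistribution
      (fun (M : ℕ) (ω : Ω) => √(M : ℝ) *
        (confHat X y s M (fun c' m d => ξ c' m d ω) c - confidence X y s c))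
      atTop (id : ℝ → ℝ) (fun _ => μ) (gaussianReal 0 (tauSq X y s D c).toNNReal) := by
  have hm := marginal_pos X y s h.nonempty hs
  set ps := marginal X y s with hps
  let θ : C → ℝ := fun c' => ∑ n ∈ Finset.range D, freq X y s c' ^ n
  let b : C → ℝ := fun c' => confGrad X y s c c' / (θ c' * ps ^ 2)
  let G : C → ℕ → Ω → ℝ := fun c' M ω =>
    (√(M : ℝ))⁻¹ * ∑ m ∈ Finset.range M, score X y s c' fun d => ξ c' m d ω
  let U : C → ℕ → Ω → ℝ := fun c' M ω => ∑ m ∈ Finset.range M,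
    ((appearances X s fun d => ξ c' m d ω : ℝ) + (chi X s fun d => ξ c' m d ω : ℝ))
  let Q : ℕ → Ω → ℝ := fun M ω => ∑ c', (freqHat X s M fun m d => ξ c' m d ω) * prior y c'
  -- The random coefficient of `G c'` in the exact linearization, minus its limit `b c'`.
  let R : C → ℕ → Ω → ℝ := fun c' M ω =>
    confGrad X y s c c' * (U c' M ω / M)⁻¹ / (ps * Q M ω) - b c'
  let W : ℕ → Ω → ℝ := fun M ω => ∑ c', b c' * G c' M ω
  let Y : ℕ → Ω → ℝ := fun M ω => √(M : ℝ) *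
    (confHat X y s M (fun c' m d => ξ c' m d ω) c - confidence X y s c)
  have hθ : ∀ c', θ c' ≠ 0 := by
    intro c'
    have h0 := freq_nonneg X y s c'
    refine ne_of_gt (lt_of_lt_of_le zero_lt_one ?_)
    simpa using Finset.single_le_sum (f := fun n => freq X y s c' ^ n)
      (fun n _ => pow_nonneg h0 n) (Finset.mem_range.2 hD)
  have hU : ∀ c' M ω, M ≠ 0 → U c' M ω ≠ 0 := by
    intro c' M ω hM
    refine ne_of_gt (Finset.sum_pos (fun m _ => ?_) (by simpa using hM))
    exact zero_lt_one.trans_le (one_le_appearances_add_chi X s _ hD)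
  have hGm : ∀ c' M, AEMeasurable (G c' M) μ := fun c' M =>
    (Finset.aemeasurable_fun_sum _ fun m _ =>
      h.aemeasurable_comp_chain (score X y s c') c' m).const_mul _
  have hUm : ∀ c' M, AEMeasurable (U c' M) μ := fun c' M =>
    Finset.aemeasurable_fun_sum _ fun m _ =>
      h.aemeasurable_comp_chain (fun i => (appearances X s i : ℝ) + chi X s i) c' m
  have hQm : ∀ M, AEMeasurable (Q M) μ := fun M =>
    Finset.aemeasurable_fun_sum _ fun c' _ => (h.aemeasurable_freqHat X s c' M).mul_const _
  have hRm : ∀ c' M, AEMeasurable (R c' M) μ := fun c' M =>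
    (((((hUm c' M).div_const _).inv).const_mul _).div ((hQm M).const_mul _)).sub_const _
  have hWm : ∀ M, AEMeasurable (W M) μ := fun M =>
    Finset.aemeasurable_fun_sum _ fun c' _ => (hGm c' M).const_mul _
  have hYm : ∀ M, AEMeasurable (Y M) μ := fun M =>
    ((((h.aemeasurable_freqHat X s c M).mul_const _).div (hQm M)).sub_const _).const_mul _
  have hQ : ∀ᵐ ω ∂μ, Tendsto (fun M => Q M ω) atTop (𝓝 ps) := by
    filter_upwards [ae_all_iff.2 fun c' => h.ae_tendsto_freqHat X s hD c'] with ω hω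
    exact tendsto_finsetSum _ fun c' _ => (hω c').mul_const _
  have hR : ∀ c', TendstoInMeasure μ (R c') atTop 0 := by
    intro c'
    refine tendstoInMeasure_of_tendsto_ae (fun M => (hRm c' M).aestronglyMeasurable) ?_
    filter_upwards [hQ, h.ae_tendsto_average
      (fun i => (appearances X s i : ℝ) + chi X s i) c'] with ω h1 h2
    rw [integral_appearances_add_chi X y s (h.nonempty c')] at h2
    have h3 := (((h2.inv₀ (hθ c')).const_mul (confGrad X y s c c')).div (h1.const_mul ps)
      (mul_ne_zero hm.ne' hm.ne')).sub_const (b c')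
    have hlim : confGrad X y s c c' * (θ c')⁻¹ / (ps * ps) - b c' = 0 := by
      have := hθ c'
      simp only [b]
      field_simp
      ring
    rw [hlim] at h3
    exact h3
  have hlin : ∀ M ω, M ≠ 0 → Q M ω ≠ 0 → Y M ω - W M ω = ∑ c', G c' M ω * R c' M ω := by
    intro M ω hM hQ0
    have hM0 : (0 : ℝ) < M := by exact_mod_cast Nat.pos_of_ne_zero hM
    simp only [Y, confHat]
    rw [confidence_eq X y s h.nonempty hs,
      confidence_sub_eq X y s c (fun c' => freqHat X s M fun m d => ξ c' m d ω) hm.ne' hQ0,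
      Finset.mul_sum, ← Finset.sum_sub_distrib]
    refine Finset.sum_congr rfl fun c' _ => ?_
    rw [freqHat_sub_freq X y s c' M _ (hU c' M ω hM)]
    change √(M : ℝ) * (confGrad X y s c c' * (_ / U c' M ω) / (ps * Q M ω)) - _ = _
    simp only [R, G]
    have h1 := hU c' M ω hM
    have h2 : √(M : ℝ) ≠ 0 := (Real.sqrt_pos.2 hM0).ne'
    have h3 : (M : ℝ) = √(M : ℝ) * √(M : ℝ) := (Real.mul_self_sqrt hM0.le).symm
    generalize (∑ m ∈ Finset.range M, score X y s c' fun d => ξ c' m d ω) = S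
    generalize √(M : ℝ) = r at h2 h3 ⊢
    rw [h3]
    field_simp
  -- `hlin` fails to apply when `Q M ω = 0`; since `ps > 0`, almost surely this happens for only
  -- finitely many `M`.
  have hrem : TendstoInMeasure μ (fun M ω => Y M ω - W M ω - ∑ c', G c' M ω * R c' M ω)
      atTop 0 := by
    refine tendstoInMeasure_of_tendsto_ae (fun M => ?_) ?_
    · exact (((hYm M).sub (hWm M)).sub (Finset.aemeasurable_fun_sum _ fun c' _ =>
        (hGm c' M).mul (hRm c' M))).aestronglyMeasurable
    · filter_upwards [hQ] with ω hω
      refine tendsto_const_nhds.congr' ?_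
      filter_upwards [hω.eventually_ne hm.ne', eventually_ne_atTop 0] with M h1 h2
      simp [hlin M ω h2 h1]
  have hGR : TendstoInMeasure μ (fun M ω => ∑ c', G c' M ω * R c' M ω) atTop 0 :=
    tendstoInMeasure_sum_zero _ fun c' => tendstoInMeasure_mul_zero
      (fun M => (memLp_finsetSum _ fun m _ =>
        h.memLp_comp_chain (score X y s c') c' m 2).const_mul _)
      (h.integral_sq_normalized_sum_le X s c') (hR c')
  have hYW : TendstoInMeasure μ (Y - W) atTop 0 := by
    convert tendstoInMeasure_add_zero hrem hGR using 3
    simp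
  have hclt := h.tendstoInDistribution_sum_score X s b
  rw [sum_confGrad_sq X y s hD c] at hclt
  exact tendstoInDistribution_of_tendstoInMeasure_sub Y id hclt hYW hYm

end IsSample

/-- The second summand of `tauSq` can be negative; nonnegativity is read off the sum-of-squares
form. -/
theorem tauSq_nonneg {N p D : ℕ} {C : Type*} [Fintype C] [DecidableEq C]
    (X : Fin N → Fin p → ℕ) (y : Fin N → C) (s : Finset (Item p)) (hD : 1 ≤ D) (c : C) :
    0 ≤ tauSq X y s D c := by
  rw [← sum_confGrad_sq X y s hD c]
  exact Finset.sum_nonneg fun c' _ => mul_nonneg (sq_nonneg _)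
    (mul_nonneg (freq_nonneg X y s c')
      (sub_nonneg.2 (pow_le_one₀ (freq_nonneg X y s c') (freq_le_one X y s c'))))

end RIChains

theorem theorem7 {N p D : ℕ} {C : Type*} [Fintype C] [DecidableEq C]
    (X : Fin N → Fin p → ℕ) (y : Fin N → C)
    (hy : ∀ c, (RIChains.classIdx y c).Nonempty)
    (s : Finset (RIChains.Item p)) (hs : (RIChains.patternIdx X s).Nonempty)
    (hD : 1 ≤ D)
    {Ω : Type*} [MeasurableSpace Ω] (μ : Measure Ω) [IsProbabilityMeasure μ]
    (ξ : C → ℕ → Fin D → Ω → Fin N)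
    (hlaw : ∀ c m d, HasLaw (ξ c m d) (uniformOn (RIChains.classIdx y c : Set (Fin N))) μ)
    (hindep : iIndepFun (fun t : C × ℕ × Fin D => ξ t.1 t.2.1 t.2.2) μ)
    (c : C) :
    0 ≤ RIChains.tauSq X y s D c ∧
    TendstoInDistribution
      (fun (M : ℕ) (ω : Ω) => √(M : ℝ) *
        (RIChains.confHat X y s M (fun c' m d => ξ c' m d ω) c - RIChains.confidence X y s c))
      atTop (id : ℝ → ℝ) (fun _ => μ)
      (gaussianReal 0 (RIChains.tauSq X y s D c).toNNReal) := by
  have h : RIChains.IsSample y ξ μ := ⟨hy, hlaw, hindep⟩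
  exact ⟨RIChains.tauSq_nonneg X y s hD c, h.tendstoInDistribution_confHat X s hs hD c⟩
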